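/- Let $\mathbb K=\mathbb R$ or $\mathbb C$. For $0<q<\infty$ let $\ell_q$ be the space of scalar sequences $x=(x_n)_{n\in\mathbb N}$ with $\|x\|_q=\big(\sum_n|x_n|^q\big)^{1/q}<\infty$, with the topology given by this (quasi-)norm, and let $\mathcal L(\ell_q;\ell_q)$ be the space of bounded linear operators on $\ell_q$ with the topology given by the (quasi-)norm $\|T\|=\sup_{\|x\|_q\le1}\|Tx\|_q$. For $1\le s\le r<\infty$ let $\Pi_{(r,s)}(\ell_q;\ell_q)$ be the set of absolutely $(r,s)$-summing operators, that is, of those $T\in\mathcal L(\ell_q;\ell_q)$ for which there is a $C>0$ with $$\Big(\sum_{i=1}^N\|Tx_i\|_q^r\Big)^{1/r}\le C\,\sup_{\varphi}\Big(\sum_{i=1}^N|\varphi(x_i)|^s\Big)^{1/s}\qquad\text{for all } N\in\mathbb N,\ x_1,\dots,x_N\in\ell_q,$$ where $\varphi$ runs over the continuous linear functionals on $\ell_q$ with $|\varphi(x)|\le\|x\|_q$ for all $x$. A subset $A$ of a topological vector space $X$ is called $\mathfrak c$-spaceable, where $\mathfrak c$ is the cardinality of $\mathbb R$, if $A\cup\{0\}$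 contains a closed linear subspace of $X$ of (algebraic) dimension $\mathfrak c$. **Theorem.** If $0<q<1$, then the set $$\mathcal L(\ell_q;\ell_q)\setminus\bigcup_{1\le s\le r<\infty}\Pi_{(r,s)}(\ell_q;\ell_q)$$ is $\mathfrak c$-spaceable. The result is sharp: if $1\le q<\infty$, then $\Pi_{(\max\{2,q\},1)}(\ell_q;\ell_q)=\mathcal L(\ell_q;\ell_q)$, and the above set is not $\mathfrak c$-spaceable. -/

import Mathlib

open Set Filter Topology

universe u v w

noncomputable section

/-- The sequence space `ℓ_q` over `𝕜`: scalar sequences with `∑ |x n| ^ q < ∞` (for `0 < q < ∞`).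
It is a type synonym of Mathlib's `lp`, so that it can carry its topology for `q < 1` as well. -/
def EllQ (𝕜 : Type u) [RCLike 𝕜] (q : ℝ) : Type u :=
  lp (fun _ : ℕ => 𝕜) (ENNReal.ofReal q)

namespace EllQ

variable {𝕜 : Type u} [RCLike 𝕜] {q : ℝ}

instance : AddCommGroup (EllQ 𝕜 q) :=
  inferInstanceAs (AddCommGroup (lp (fun _ : ℕ => 𝕜) (ENNReal.ofReal q)))

instance : Module 𝕜 (EllQ 𝕜 q) :=
  inferInstanceAs (Module 𝕜 (lp (fun _ : ℕ => 𝕜) (ENNReal.ofReal q)))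

/-- The quasi-norm `‖x‖ = (∑ |x n| ^ q) ^ (1 / q)`, see `EllQ.norm_eq`. -/
instance : Norm (EllQ 𝕜 q) :=
  inferInstanceAs (Norm (lp (fun _ : ℕ => 𝕜) (ENNReal.ofReal q)))

/-- A sequence in `ℓ_q` as an element of Mathlib's `lp`. -/
def toLp (x : EllQ 𝕜 q) : lp (fun _ : ℕ => 𝕜) (ENNReal.ofReal q) := x

/-- The `n`-th coordinate of a sequence in `ℓ_q`. -/
def coord (x : EllQ 𝕜 q) (n : ℕ) : 𝕜 :=
  x.toLp.1 n

theorem coord_add (x y : EllQ 𝕜 q) (n : ℕ) : (x + y).coord n = x.coord n + y.coord n := rfl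

theorem coord_smul (c : 𝕜) (x : EllQ 𝕜 q) (n : ℕ) : (c • x).coord n = c * x.coord n := rfl

theorem summable [hq : Fact (0 < q)] (x : EllQ 𝕜 q) : Summable fun n => ‖x.coord n‖ ^ q := by
  have h1 := ENNReal.toReal_ofReal hq.out.le
  have h2 := (memℓp_gen_iff (p := ENNReal.ofReal q) (by rw [h1]; exact hq.out)).1
    (lp.memℓp x.toLp)
  rw [h1] at h2
  exact h2

theorem norm_eq [hq : Fact (0 < q)] (x : EllQ 𝕜 q) :
    ‖x‖ = (∑' n, ‖x.coord n‖ ^ q) ^ (1 / q) := by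
  have h1 := ENNReal.toReal_ofReal hq.out.le
  have h2 := lp.norm_eq_tsum_rpow (p := ENNReal.ofReal q) (by rw [h1]; exact hq.out)
    x.toLp
  rw [h1] at h2
  exact h2

theorem norm_nonneg (x : EllQ 𝕜 q) : 0 ≤ ‖x‖ :=
  lp.norm_nonneg' x.toLp

theorem norm_zero : ‖(0 : EllQ 𝕜 q)‖ = 0 :=
  lp.norm_zero (E := fun _ : ℕ => 𝕜) (p := ENNReal.ofReal q)

theorem norm_neg (x : EllQ 𝕜 q) : ‖-x‖ = ‖x‖ :=
  lp.norm_neg (f := x.toLp)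

theorem eq_zero_of_norm (x : EllQ 𝕜 q) (h : ‖x‖ = 0) : x = 0 :=
  lp.norm_eq_zero_iff.1 (show ‖x.toLp‖ = 0 from h)

theorem norm_smul [hq : Fact (0 < q)] (c : 𝕜) (x : EllQ 𝕜 q) : ‖c • x‖ = ‖c‖ * ‖x‖ :=
  lp.norm_const_smul (ENNReal.ofReal_pos.2 hq.out).ne' (c := c)
    (f := x.toLp)

/-- The quasi-norm of `ℓ_q` is `min 1 q`-subadditive. -/
theorem norm_add_rpow_le [hq : Fact (0 < q)] (x y : EllQ 𝕜 q) :
    ‖x + y‖ ^ min 1 q ≤ ‖x‖ ^ min 1 q + ‖y‖ ^ min 1 q := by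
  have h0 := hq.out
  rcases le_total q 1 with h | h
  · have key : ∀ z : EllQ 𝕜 q, ‖z‖ ^ q = ∑' n, ‖z.coord n‖ ^ q := fun z => by
      rw [norm_eq, ← Real.rpow_mul (tsum_nonneg fun n => by positivity),
        one_div_mul_cancel h0.ne', Real.rpow_one]
    rw [min_eq_right h, key, key, key, ← (summable x).tsum_add (summable y)]
    refine (summable (x + y)).tsum_le_tsum (fun n => ?_) ((summable x).add (summable y))
    rw [coord_add]
    exact (Real.rpow_le_rpow (_root_.norm_nonneg _) (norm_add_le _ _) h0.le).trans
      (Real.rpow_add_le_add_rpow (_root_.norm_nonneg _) (_root_.norm_nonneg _) h0.le h)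
  · rw [min_eq_left h, Real.rpow_one, Real.rpow_one, Real.rpow_one]
    have : Fact (1 ≤ ENNReal.ofReal q) := ⟨ENNReal.one_le_ofReal.2 h⟩
    exact norm_add_le x.toLp
      y.toLp

theorem min_pos [hq : Fact (0 < q)] : 0 < min 1 q := lt_min one_pos hq.out

/-- The translation invariant metric `‖x - y‖ ^ min 1 q`; its topology is the usual (quasi-norm)
topology of `ℓ_q`, see `EllQ.hasBasis_nhds_zero`. -/
instance [Fact (0 < q)] : MetricSpace (EllQ 𝕜 q) where
  dist x y := ‖x - y‖ ^ min 1 q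
  dist_self x := by rw [sub_self, norm_zero, Real.zero_rpow min_pos.ne']
  dist_comm x y := by rw [← norm_neg (x - y), neg_sub]
  dist_triangle x y z := by simpa using norm_add_rpow_le (x - y) (y - z)
  eq_of_dist_eq_zero {x y} h :=
    sub_eq_zero.1 <| eq_zero_of_norm _ <|
      (Real.rpow_eq_zero (norm_nonneg _) min_pos.ne').1 h

theorem dist_eq [Fact (0 < q)] (x y : EllQ 𝕜 q) : dist x y = ‖x - y‖ ^ min 1 q := rfl

instance [Fact (0 < q)] : IsTopologicalAddGroup (EllQ 𝕜 q) where
  continuous_add := by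
    refine (LipschitzWith.of_dist_le_mul (K := 2) fun a b => ?_).continuous
    have h1 : dist a.1 b.1 ≤ dist a b := le_max_left _ _
    have h2 : dist a.2 b.2 ≤ dist a b := le_max_right _ _
    have h3 : dist (a.1 + a.2) (b.1 + b.2) ≤ dist a.1 b.1 + dist a.2 b.2 := by
      simp only [dist_eq, add_sub_add_comm]
      exact norm_add_rpow_le _ _
    rw [NNReal.coe_ofNat]
    linarith
  continuous_neg := by
    refine (LipschitzWith.of_dist_le_mul (K := 1) fun a b => ?_).continuous
    rw [NNReal.coe_one, one_mul, dist_eq, dist_eq, ← norm_neg (-a - -b)]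
    simp [add_comm, sub_eq_add_neg]

instance [Fact (0 < q)] : ContinuousSMul 𝕜 (EllQ 𝕜 q) where
  continuous_smul := by
    rw [continuous_iff_continuousAt]
    rintro ⟨c, x⟩
    refine tendsto_iff_dist_tendsto_zero.2 ?_
    have hp : 0 < min 1 q := min_pos
    have hb : ∀ z : 𝕜 × EllQ 𝕜 q, dist (z.1 • z.2) (c • x)
        ≤ ‖z.1‖ ^ min 1 q * dist z.2 x + ‖z.1 - c‖ ^ min 1 q * ‖x‖ ^ min 1 q := fun z => by
      have h : z.1 • z.2 - c • x = z.1 • (z.2 - x) + (z.1 - c) • x := by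
        rw [smul_sub, sub_smul]; abel
      rw [dist_eq, h, dist_eq]
      refine (norm_add_rpow_le _ _).trans (le_of_eq ?_)
      rw [norm_smul, norm_smul, Real.mul_rpow (_root_.norm_nonneg _) (norm_nonneg _),
        Real.mul_rpow (_root_.norm_nonneg _) (norm_nonneg _)]
    refine squeeze_zero (fun _ => dist_nonneg) hb ?_
    have hc : Continuous fun z : 𝕜 × EllQ 𝕜 q =>
        ‖z.1‖ ^ min 1 q * dist z.2 x + ‖z.1 - c‖ ^ min 1 q * ‖x‖ ^ min 1 q := by
      refine ((continuous_fst.norm.rpow_const fun _ => Or.inr hp.le).mul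
        (continuous_snd.dist continuous_const)).add
        (((continuous_fst.sub continuous_const).norm.rpow_const fun _ => Or.inr hp.le).mul
          continuous_const)
    simpa [Real.zero_rpow hp.ne'] using hc.tendsto (c, x)

/-- The balls of the quasi-norm are a base of neighbourhoods of the origin. -/
theorem hasBasis_nhds_zero [Fact (0 < q)] :
    (𝓝 (0 : EllQ 𝕜 q)).HasBasis (fun ε : ℝ => 0 < ε) fun ε => {x | ‖x‖ < ε} := by
  have hp : 0 < min 1 q := min_pos
  refine Metric.nhds_basis_ball.to_hasBasis (fun ε hε => ?_) (fun ε hε => ?_)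
  · refine ⟨ε ^ (1 / min 1 q), by positivity, fun x hx => ?_⟩
    rw [Metric.mem_ball, dist_eq, sub_zero]
    calc ‖x‖ ^ min 1 q < (ε ^ (1 / min 1 q)) ^ min 1 q :=
          Real.rpow_lt_rpow (norm_nonneg x) hx hp
      _ = ε := by rw [← Real.rpow_mul hε.le, one_div_mul_cancel hp.ne', Real.rpow_one]
  · refine ⟨ε ^ min 1 q, by positivity, fun x hx => ?_⟩
    rw [Metric.mem_ball, dist_eq, sub_zero] at hx
    exact (Real.rpow_lt_rpow_iff (norm_nonneg x) hε.le hp).1 hx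

/-- The topology which Mathlib puts on `ℒ(ℓ_q; ℓ_q)` is the one of the operator quasi-norm
`sup {‖T x‖ : ‖x‖ ≤ 1}`. -/
theorem hasBasis_nhds_zero_clm [Fact (0 < q)] :
    (𝓝 (0 : EllQ 𝕜 q →L[𝕜] EllQ 𝕜 q)).HasBasis (fun ε : ℝ => 0 < ε)
      fun ε => {T | ∀ x, ‖x‖ ≤ 1 → ‖T x‖ < ε} := by
  refine (ContinuousLinearMap.hasBasis_nhds_zero_of_basis hasBasis_nhds_zero).to_hasBasis ?_ ?_
  · rintro ⟨S, ε⟩ ⟨hS, hε⟩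
    obtain ⟨c, hc0, hc⟩ := (hS (hasBasis_nhds_zero.mem_of_mem one_pos)).exists_pos
    have hc1 : ‖((c : ℝ) : 𝕜)‖ = c := by simp [abs_of_pos hc0]
    have hcne : ((c : ℝ) : 𝕜) ≠ 0 := by simpa using hc0.ne'
    refine ⟨ε / c, by positivity, fun T hT x hx => ?_⟩
    obtain ⟨y, hy, rfl⟩ := hc ((c : ℝ) : 𝕜) hc1.ge hx
    have h2 := hT y (le_of_lt hy)
    change ‖T (((c : ℝ) : 𝕜) • y)‖ < ε
    rw [map_smul, norm_smul, hc1]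
    rw [lt_div_iff₀ hc0] at h2
    linarith
  · intro ε hε
    refine ⟨({x | ‖x‖ ≤ 1}, ε), ⟨?_, hε⟩, fun T hT x hx => hT x hx⟩
    refine (hasBasis_nhds_zero.isVonNBounded_iff).2 fun δ hδ => ?_
    refine Absorbs.of_norm ⟨2 / δ, fun a ha x hx => ?_⟩
    have hd : 0 < 2 / δ := by positivity
    have ha0 : 0 < ‖a‖ := hd.trans_le ha
    have hane : a ≠ 0 := norm_pos_iff.1 ha0
    refine ⟨a⁻¹ • x, ?_, smul_inv_smul₀ hane x⟩
    have hx1 : ‖x‖ ≤ 1 := hx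
    change ‖a⁻¹ • x‖ < δ
    rw [norm_smul, norm_inv, inv_mul_lt_iff₀ ha0]
    rw [div_le_iff₀ hδ] at ha
    linarith

end EllQ

/-- The closed unit ball of the topological dual of a (quasi-)normed space. -/
def dualBall (𝕜 : Type u) (E : Type v) [RCLike 𝕜] [AddCommGroup E] [Module 𝕜 E]
    [TopologicalSpace E] [Norm E] : Set (E →L[𝕜] 𝕜) :=
  {φ | ∀ x : E, ‖φ x‖ ≤ ‖x‖}

/-- `T ∈ Π_{(r,s)}(E; F)`: the operator `T` is absolutely `(r, s)`-summing. The supremum is over a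
bounded set of real numbers, because `‖φ (x i)‖ ≤ ‖x i‖` for `φ` in the dual ball. -/
def IsAbsSumming {𝕜 : Type u} {E : Type v} {F : Type w} [RCLike 𝕜]
    [AddCommGroup E] [Module 𝕜 E] [TopologicalSpace E] [Norm E]
    [AddCommGroup F] [Module 𝕜 F] [TopologicalSpace F] [Norm F]
    (r s : ℝ) (T : E →L[𝕜] F) : Prop :=
  ∃ C : ℝ, 0 < C ∧ ∀ (N : ℕ) (x : Fin N → E),
    (∑ i, ‖T (x i)‖ ^ r) ^ (1 / r) ≤
      C * ⨆ φ : dualBall 𝕜 E, (∑ i, ‖φ.1 (x i)‖ ^ s) ^ (1 / s)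

/-- A subset `A` of a topological vector space `X` is `κ`-spaceable if `A ∪ {0}` contains a closed
`κ`-dimensional linear subspace of `X`. -/
def IsSpaceable (𝕜 : Type u) {X : Type v} [RCLike 𝕜] [AddCommGroup X] [Module 𝕜 X]
    [TopologicalSpace X] (κ : Cardinal.{v}) (A : Set X) : Prop :=
  ∃ W : Submodule 𝕜 X, IsClosed (W : Set X) ∧ Module.rank 𝕜 W = κ ∧ (W : Set X) ⊆ A ∪ {0}

/-- `ℒ(ℓ_q; ℓ_q) ∖ ⋃_{1 ≤ s ≤ r < ∞} Π_{(r,s)}(ℓ_q; ℓ_q)`. -/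
def nonSummingOps (𝕜 : Type u) [RCLike 𝕜] (q : ℝ) [Fact (0 < q)] :
    Set (EllQ 𝕜 q →L[𝕜] EllQ 𝕜 q) :=
  univ \ ⋃ (r : ℝ) (s : ℝ) (_ : 1 ≤ s ∧ s ≤ r), {T | IsAbsSumming r s T}

end

/-! ### Coordinates and bounded operators on `ℓ_q`. -/

noncomputable section

namespace EllQ

variable {𝕜 : Type u} [RCLike 𝕜] {q : ℝ}

/-! For `q < 1` the vector `e_0 + ... + e_{N-1}` has quasi-norm `N ^ (1/q)`, while every functional
in the dual ball is at most `N` on it. As `N ^ (1/q - 1)` is unbounded, this single vector already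
prevents an operator that is bounded below from being `(r, s)`-summing
(`not_isAbsSumming_of_bound_below`). The operators `x ↦ a ⊗ x` form a linear space whose nonzero
members are all bounded below. It is closed, being cut out by continuous equations, and geometric
sequences `a` give it dimension continuum.

For `q ≥ 1` the claim is that `ℓ_q` has cotype `max 2 q`. By Hahn–Banach the weak `ℓ_1` norm of
`(x_i)` bounds the norm of every signed sum `∑ ± x_i`. Averaging over signs and applying Khinchine
in each coordinate bounds the square function (`square_function_le`), which dominates `(∑ ‖x_i‖ ^
max 2 q) ^ (1 / max 2 q)` (`rpow_sum_norm_rpow_le_square_function`). So no operator is left outside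
the union, and `{0}` has dimension `0`. -/

theorem ext_coord {x y : EllQ 𝕜 q} (h : ∀ n, x.coord n = y.coord n) : x = y :=
  lp.ext (E := fun _ : ℕ => 𝕜) (p := ENNReal.ofReal q) (f := x.toLp) (g := y.toLp) (funext h)

/-- The element of `ℓ_q` with given coordinates. -/
def ofSummable [hq : Fact (0 < q)] (f : ℕ → 𝕜) (hf : Summable fun n => ‖f n‖ ^ q) : EllQ 𝕜 q :=
  (⟨f, by
    have h1 := ENNReal.toReal_ofReal hq.out.le
    refine (memℓp_gen_iff (p := ENNReal.ofReal q) (by rw [h1]; exact hq.out)).2 ?_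
    rw [h1]
    exact hf⟩ : lp (fun _ : ℕ => 𝕜) (ENNReal.ofReal q))

theorem coord_ofSummable [Fact (0 < q)] (f : ℕ → 𝕜) (hf : Summable fun n => ‖f n‖ ^ q) (n : ℕ) :
    (ofSummable f hf).coord n = f n := rfl

theorem norm_rpow [hq : Fact (0 < q)] (x : EllQ 𝕜 q) : ‖x‖ ^ q = ∑' n, ‖x.coord n‖ ^ q := by
  rw [norm_eq, ← Real.rpow_mul (tsum_nonneg fun n => by positivity),
    one_div_mul_cancel hq.out.ne', Real.rpow_one]

theorem norm_coord_le [hq : Fact (0 < q)] (x : EllQ 𝕜 q) (n : ℕ) : ‖x.coord n‖ ≤ ‖x‖ := by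
  refine (Real.rpow_le_rpow_iff (_root_.norm_nonneg _) (norm_nonneg x) hq.out).1 ?_
  rw [norm_rpow]
  exact (summable x).le_tsum n fun _ _ => by positivity

/-- The target enters only through its balls at the origin, so that both the scalars and `ℓ_q` with
`q < 1`, which is not normed, qualify. -/
theorem continuous_of_bound {E : Type*} [AddCommGroup E] [Module 𝕜 E] [TopologicalSpace E]
    [IsTopologicalAddGroup E] [Norm E]
    (hE : (𝓝 (0 : E)).HasBasis (fun ε : ℝ => 0 < ε) fun ε => {x | ‖x‖ < ε})
    [Fact (0 < q)] (T : EllQ 𝕜 q →ₗ[𝕜] E) (C : ℝ) (hC : ∀ x, ‖T x‖ ≤ C * ‖x‖) :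
    Continuous T := by
  refine continuous_of_continuousAt_zero T ?_
  rw [ContinuousAt, map_zero, hasBasis_nhds_zero.tendsto_iff hE]
  intro ε hε
  refine ⟨ε / (|C| + 1), by positivity, fun x hx => ?_⟩
  have h1 : ‖x‖ < ε / (|C| + 1) := hx
  rw [lt_div_iff₀ (by positivity)] at h1
  have h2 : C * ‖x‖ ≤ |C| * ‖x‖ := mul_le_mul_of_nonneg_right (le_abs_self C) (norm_nonneg x)
  change ‖T x‖ < ε
  linarith [hC x, norm_nonneg x]

theorem hasBasis_nhds_zero_norm {E : Type*} [SeminormedAddCommGroup E] :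
    (𝓝 (0 : E)).HasBasis (fun ε : ℝ => 0 < ε) fun ε => {x | ‖x‖ < ε} := by
  simp only [← ball_zero_eq]
  exact Metric.nhds_basis_ball

/-- The `n`-th coordinate as a continuous linear functional. -/
def coordCLM [Fact (0 < q)] (n : ℕ) : EllQ 𝕜 q →L[𝕜] 𝕜 :=
  let f : EllQ 𝕜 q →ₗ[𝕜] 𝕜 :=
    { toFun := fun x => x.coord n, map_add' := fun _ _ => rfl, map_smul' := fun _ _ => rfl }
  ⟨f, continuous_of_bound hasBasis_nhds_zero_norm f 1 fun x => by
    rw [one_mul]; exact norm_coord_le x n⟩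

theorem coordCLM_apply [Fact (0 < q)] (n : ℕ) (x : EllQ 𝕜 q) : coordCLM n x = x.coord n := rfl

theorem exists_bound [Fact (0 < q)] (T : EllQ 𝕜 q →L[𝕜] EllQ 𝕜 q) :
    ∃ C : ℝ, 0 < C ∧ ∀ x, ‖T x‖ ≤ C * ‖x‖ := by
  have h := T.continuous.tendsto 0
  rw [map_zero, hasBasis_nhds_zero.tendsto_iff hasBasis_nhds_zero] at h
  obtain ⟨δ, hδ, h⟩ := h 1 one_pos
  refine ⟨2 / δ, by positivity, fun x => ?_⟩
  rcases (norm_nonneg x).eq_or_lt with h0 | h0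
  · rw [eq_zero_of_norm x h0.symm, map_zero, norm_zero, mul_zero]
  · set c : 𝕜 := ((δ / (2 * ‖x‖) : ℝ) : 𝕜) with hc
    have hcn : ‖c‖ = δ / (2 * ‖x‖) := by
      rw [hc, RCLike.norm_ofReal, abs_of_pos (by positivity)]
    have h1 : ‖T (c • x)‖ < 1 := h (c • x) (by
      change ‖c • x‖ < δ
      rw [norm_smul, hcn]
      field_simp
      linarith)
    rw [map_smul, norm_smul, hcn, div_mul_eq_mul_div, div_lt_one (by positivity)] at h1
    rw [div_mul_eq_mul_div, le_div_iff₀ hδ]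
    linarith

/-! ### Unit vectors and their sums. -/

section Basis

variable [hq : Fact (0 < q)]

/-- The unit vectors of `ℓ_q`. -/
def basisVec (i : ℕ) : EllQ 𝕜 q :=
  ofSummable (fun n => if n = i then 1 else 0)
    (summable_of_ne_finset_zero (s := {i}) fun n hn => by
      simp [Finset.mem_singleton.not.1 hn, Real.zero_rpow hq.out.ne'])

theorem coord_basisVec (i n : ℕ) :
    (basisVec i : EllQ 𝕜 q).coord n = if n = i then 1 else 0 := rfl

theorem norm_basisVec (i : ℕ) : ‖(basisVec i : EllQ 𝕜 q)‖ = 1 := by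
  rw [norm_eq, tsum_eq_single i fun n hn => by
    rw [coord_basisVec, if_neg hn, _root_.norm_zero, Real.zero_rpow hq.out.ne']]
  simp [coord_basisVec]

theorem coord_sum_basisVec (N n : ℕ) :
    (∑ i ∈ Finset.range N, (basisVec i : EllQ 𝕜 q)).coord n = if n < N then 1 else 0 := by
  rw [← coordCLM_apply, map_sum]
  simp [coordCLM_apply, coord_basisVec]

theorem norm_sum_basisVec (N : ℕ) :
    ‖∑ i ∈ Finset.range N, (basisVec i : EllQ 𝕜 q)‖ = (N : ℝ) ^ (1 / q) := by
  rw [norm_eq, tsum_eq_sum (s := Finset.range N) fun n hn => by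
    rw [coord_sum_basisVec, if_neg (Finset.mem_range.not.1 hn), _root_.norm_zero,
      Real.zero_rpow hq.out.ne']]
  congr 1
  rw [Finset.sum_congr rfl fun n hn => by
    rw [coord_sum_basisVec, if_pos (Finset.mem_range.1 hn), norm_one, Real.one_rpow]]
  simp

end Basis

/-! ### The case `q < 1`: operators `x ↦ a ⊗ x`. -/

section Small

variable [hq : Fact (0 < q)]

/-- For `q < 1`, an operator which is bounded below is not absolutely summing. -/
theorem not_isAbsSumming_of_bound_below (hq1 : q < 1) (T : EllQ 𝕜 q →L[𝕜] EllQ 𝕜 q) (c : ℝ)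
    (hc : 0 < c) (hT : ∀ x, c * ‖x‖ ≤ ‖T x‖) {r s : ℝ} (hs : 0 < s) (hr : 0 < r) :
    ¬ IsAbsSumming r s T := by
  rintro ⟨C, hC, h⟩
  have key : ∀ N : ℕ, c * (N : ℝ) ^ (1 / q) ≤ C * N := fun N => by
    -- A family of one vector suffices; the exponents `r` and `s` then cancel.
    have h1 := h 1 fun _ => ∑ i ∈ Finset.range N, basisVec i
    simp only [Finset.univ_unique, Finset.sum_const, Finset.card_singleton, one_smul] at h1
    rw [← Real.rpow_mul (norm_nonneg _), mul_one_div_cancel hr.ne', Real.rpow_one] at h1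
    rw [← norm_sum_basisVec (𝕜 := 𝕜)]
    refine (hT _).trans (h1.trans (mul_le_mul_of_nonneg_left ?_ hC.le))
    refine Real.iSup_le (fun φ => ?_) N.cast_nonneg
    rw [← Real.rpow_mul (_root_.norm_nonneg _), mul_one_div_cancel hs.ne', Real.rpow_one, map_sum]
    refine (norm_sum_le _ _).trans ((Finset.sum_le_sum fun i _ => φ.2 (basisVec i)).trans ?_)
    simp [norm_basisVec]
  have hpos : 0 < 1 / q - 1 := by
    rw [sub_pos, lt_div_iff₀ hq.out, one_mul]; exact hq1
  have ht := ((tendsto_rpow_atTop hpos).comp tendsto_natCast_atTop_atTop).eventually_gt_atTop (C / c)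
  obtain ⟨N, hN, hN0⟩ := (ht.and (eventually_gt_atTop 0)).exists
  have hNR : (0 : ℝ) < N := Nat.cast_pos.2 hN0
  have h2 := key N
  simp only [Function.comp] at hN
  rw [Real.rpow_sub_one hNR.ne', lt_div_iff₀ hNR, div_mul_eq_mul_div, div_lt_iff₀ hc] at hN
  linarith

/-- The operators `x ↦ a ⊗ x` with `a ∈ ℓ_q`, where `ℓ_q(ℕ × ℕ)` is identified with `ℓ_q`. -/
def tensorOps (𝕜 : Type u) [RCLike 𝕜] (q : ℝ) [Fact (0 < q)] :
    Submodule 𝕜 (EllQ 𝕜 q →L[𝕜] EllQ 𝕜 q) where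
  -- The entry `a k` is read off as the coordinate `(k, 0)` of `T e_0`. Without a quantifier over
  -- `a`, the condition is a family of continuous equations in `T`.
  carrier := {T | ∀ x k n,
    (T x).coord (Nat.pair k n) = (T (basisVec 0)).coord (Nat.pair k 0) * x.coord n}
  add_mem' {S T} hS hT x k n := by
    simp only [_root_.add_apply, coord_add, hS x k n, hT x k n, add_mul]
  zero_mem' x k n := by
    change (0 : 𝕜) = 0 * x.coord n
    rw [zero_mul]
  smul_mem' c T hT x k n := by
    simp only [_root_.smul_apply, coord_smul, hT x k n, mul_assoc]

theorem mem_tensorOps {T : EllQ 𝕜 q →L[𝕜] EllQ 𝕜 q} : T ∈ tensorOps 𝕜 q ↔ ∀ x k n,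
    (T x).coord (Nat.pair k n) = (T (basisVec 0)).coord (Nat.pair k 0) * x.coord n := Iff.rfl

theorem isClosed_tensorOps : IsClosed (tensorOps 𝕜 q : Set (EllQ 𝕜 q →L[𝕜] EllQ 𝕜 q)) := by
  have hev : ∀ (x : EllQ 𝕜 q) (m : ℕ),
      Continuous fun T : EllQ 𝕜 q →L[𝕜] EllQ 𝕜 q => (T x).coord m := fun x m =>
    (coordCLM m).continuous.comp (continuous_eval_const x)
  have : (tensorOps 𝕜 q : Set (EllQ 𝕜 q →L[𝕜] EllQ 𝕜 q)) = ⋂ (x) (k) (n), {T |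
      (T x).coord (Nat.pair k n) = (T (basisVec 0)).coord (Nat.pair k 0) * x.coord n} := by
    ext T; simp [mem_tensorOps]
  rw [this]
  exact isClosed_iInter fun x => isClosed_iInter fun k => isClosed_iInter fun n =>
    isClosed_eq (hev x _) ((hev _ _).mul continuous_const)

/-- The sequence `a` of an operator `x ↦ a ⊗ x`. -/
def symbol (𝕜 : Type u) [RCLike 𝕜] (q : ℝ) [Fact (0 < q)] : tensorOps 𝕜 q →ₗ[𝕜] ℕ → 𝕜 where
  toFun T k := (T.1 (basisVec 0)).coord (Nat.pair k 0)
  map_add' _ _ := rfl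
  map_smul' _ _ := rfl

theorem coord_tensorOps (T : tensorOps 𝕜 q) (x : EllQ 𝕜 q) (k n : ℕ) :
    (T.1 x).coord (Nat.pair k n) = symbol 𝕜 q T k * x.coord n := T.2 x k n

theorem symbol_injective : Function.Injective (symbol 𝕜 q) := by
  refine (injective_iff_map_eq_zero _).2 fun T hT => Subtype.ext ?_
  refine ContinuousLinearMap.ext fun x => ext_coord fun m => ?_
  rw [← Nat.pair_unpair m, coord_tensorOps, hT]
  exact zero_mul _

/-- The `k`-th row of `a ⊗ x` is `a k • x`. One nonzero entry of the symbol therefore bounds the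
operator below, and the symbol need not be known to lie in `ℓ_q`. -/
theorem norm_tensorOps_ge (T : tensorOps 𝕜 q) (k : ℕ) (x : EllQ 𝕜 q) :
    ‖symbol 𝕜 q T k‖ * ‖x‖ ≤ ‖T.1 x‖ := by
  refine (Real.rpow_le_rpow_iff (mul_nonneg (_root_.norm_nonneg _) (norm_nonneg x))
    (norm_nonneg _) hq.out).1 ?_
  rw [Real.mul_rpow (_root_.norm_nonneg _) (norm_nonneg x), norm_rpow, norm_rpow, ← tsum_mul_left]
  have hinj : Function.Injective fun n => Nat.pair k n := fun a b h => (Nat.pair_eq_pair.1 h).2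
  refine Summable.tsum_le_tsum_of_inj _ hinj (fun _ _ => by positivity) (fun n => ?_)
    ((summable x).mul_left _) (summable (T.1 x))
  rw [coord_tensorOps, norm_mul, Real.mul_rpow (_root_.norm_nonneg _) (_root_.norm_nonneg _)]

theorem summable_tensor (a x : EllQ 𝕜 q) :
    Summable fun m : ℕ => ‖a.coord m.unpair.1 * x.coord m.unpair.2‖ ^ q := by
  have h := (summable a).mul_of_nonneg (summable x) (fun _ => by positivity) fun _ => by positivity
  refine ((Nat.pairEquiv.symm.summable_iff).2 h).congr fun m => ?_
  rw [norm_mul, Real.mul_rpow (_root_.norm_nonneg _) (_root_.norm_nonneg _)]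
  rfl

theorem norm_tensor (a x : EllQ 𝕜 q) : ‖ofSummable _ (summable_tensor a x)‖ = ‖a‖ * ‖x‖ := by
  rw [← Real.rpow_left_inj (norm_nonneg _) (mul_nonneg (norm_nonneg _) (norm_nonneg _)) hq.out.ne',
    Real.mul_rpow (norm_nonneg _) (norm_nonneg _), norm_rpow, norm_rpow, norm_rpow,
    (summable a).tsum_mul_tsum (summable x)
      ((summable a).mul_of_nonneg (summable x) (fun _ => by positivity) fun _ => by positivity),
    ← Nat.pairEquiv.symm.tsum_eq]
  refine tsum_congr fun m => ?_
  rw [coord_ofSummable, norm_mul, Real.mul_rpow (_root_.norm_nonneg _) (_root_.norm_nonneg _)]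
  rfl

/-- The operator `x ↦ a ⊗ x`. -/
def tensorOp (a : EllQ 𝕜 q) : EllQ 𝕜 q →L[𝕜] EllQ 𝕜 q :=
  let f : EllQ 𝕜 q →ₗ[𝕜] EllQ 𝕜 q :=
    { toFun := fun x => ofSummable _ (summable_tensor a x)
      map_add' := fun _ _ => ext_coord fun _ => mul_add _ _ _
      map_smul' := fun _ _ => ext_coord fun _ => mul_left_comm _ _ _ }
  ⟨f, continuous_of_bound hasBasis_nhds_zero f ‖a‖ fun x => (norm_tensor a x).le⟩

theorem coord_tensorOp (a x : EllQ 𝕜 q) (k n : ℕ) :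
    (tensorOp a x).coord (Nat.pair k n) = a.coord k * x.coord n := by
  change a.coord (Nat.unpair (Nat.pair k n)).1 * x.coord (Nat.unpair (Nat.pair k n)).2 = _
  rw [Nat.unpair_pair]

theorem tensorOp_mem (a : EllQ 𝕜 q) : tensorOp a ∈ tensorOps 𝕜 q := fun x k n => by
  rw [coord_tensorOp, coord_tensorOp, coord_basisVec, if_pos rfl, mul_one]

theorem symbol_tensorOp (a : EllQ 𝕜 q) (k : ℕ) :
    symbol 𝕜 q ⟨tensorOp a, tensorOp_mem a⟩ k = a.coord k := by
  change (tensorOp a (basisVec 0)).coord (Nat.pair k 0) = _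
  rw [coord_tensorOp, coord_basisVec, if_pos rfl, mul_one]

/-- The geometric sequence of ratio `t`. -/
def geom (t : Metric.ball (0 : 𝕜) 1) : EllQ 𝕜 q :=
  ofSummable (fun n => t.1 ^ n) (by
    have ht : ‖t.1‖ < 1 := mem_ball_zero_iff.1 t.2
    refine (summable_geometric_of_lt_one (r := ‖t.1‖ ^ q) (by positivity)
      (Real.rpow_lt_one (_root_.norm_nonneg _) ht hq.out)).congr fun n => ?_
    rw [norm_pow, ← Real.rpow_natCast, ← Real.rpow_mul (_root_.norm_nonneg _), mul_comm,
      Real.rpow_mul (_root_.norm_nonneg _), Real.rpow_natCast])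

/-- Geometric sequences are eigenvectors of the left shift with distinct eigenvalues `t`. -/
theorem linearIndependent_pow {K : Type*} [Field K] :
    LinearIndependent K fun (t : K) (n : ℕ) => t ^ n := by
  refine Module.End.eigenvectors_linearIndependent' (LinearMap.funLeft K K Nat.succ) id
    Function.injective_id _ fun t => ⟨?_, fun h => ?_⟩
  · refine Module.End.mem_eigenspace_iff.2 (funext fun n => ?_)
    simp [LinearMap.funLeft_apply, pow_succ']
  -- The entry at `0` is `t ^ 0 = 1`, also for `t = 0`.
  · simpa using congrFun h 0

theorem mk_ball_rclike (𝕜 : Type u) [RCLike 𝕜] :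
    Cardinal.mk (Metric.ball (0 : 𝕜) 1) = Cardinal.mk 𝕜 :=
  cardinal_eq_of_mem_nhds 𝕜 (Metric.ball_mem_nhds 0 one_pos)

theorem mk_rclike (𝕜 : Type u) [RCLike 𝕜] : Cardinal.mk 𝕜 = Cardinal.continuum := by
  refine le_antisymm ?_ (continuum_le_cardinal_of_nontriviallyNormedField 𝕜)
  have hinj : Function.Injective fun z : 𝕜 => (RCLike.re z, RCLike.im z) := fun a b h =>
    RCLike.ext (congrArg Prod.fst h) (congrArg Prod.snd h)
  simpa [Cardinal.mk_real] using Cardinal.lift_mk_le_lift_mk_of_injective hinj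

theorem rank_tensorOps : Module.rank 𝕜 (tensorOps 𝕜 q) = Cardinal.continuum := by
  refine le_antisymm ((rank_le_card 𝕜 _).trans ?_) ?_
  -- There are only continuum many scalar sequences.
  · refine (Cardinal.mk_le_of_injective symbol_injective).trans ?_
    simp [mk_rclike]
  · have h : LinearIndependent 𝕜 fun t : Metric.ball (0 : 𝕜) 1 =>
        (⟨tensorOp (geom t), tensorOp_mem _⟩ : tensorOps 𝕜 q) := by
      refine LinearIndependent.of_comp (symbol 𝕜 q) ?_
      have hgeom : (symbol 𝕜 q ∘ fun t : Metric.ball (0 : 𝕜) 1 => ⟨tensorOp (geom t),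
          tensorOp_mem _⟩) = (fun (t : 𝕜) (n : ℕ) => t ^ n) ∘ Subtype.val :=
        funext fun t => funext fun k => symbol_tensorOp (geom t) k
      rw [hgeom]
      exact linearIndependent_pow.comp _ Subtype.val_injective
    simpa [mk_ball_rclike, mk_rclike] using h.cardinal_le_rank

theorem isSpaceable_nonSummingOps (hq1 : q < 1) :
    IsSpaceable 𝕜 Cardinal.continuum (nonSummingOps 𝕜 q) := by
  refine ⟨tensorOps 𝕜 q, isClosed_tensorOps, rank_tensorOps, fun T hT => ?_⟩
  by_cases h : symbol 𝕜 q ⟨T, hT⟩ = 0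
  · right
    exact congrArg Subtype.val ((injective_iff_map_eq_zero _).1 symbol_injective _ h)
  · left
    obtain ⟨k, hk⟩ := Function.ne_iff.1 h
    refine ⟨mem_univ _, fun hmem => ?_⟩
    simp only [mem_iUnion] at hmem
    obtain ⟨r, s, ⟨hs, hr⟩, hsum⟩ := hmem
    exact not_isAbsSumming_of_bound_below hq1 T _ (norm_pos_iff.2 hk)
      (norm_tensorOps_ge ⟨T, hT⟩ k) (by linarith) (by linarith) hsum

end Small

end EllQ

/-! ### Random signs and Khinchine's inequality. -/

/-- The sum of the vectors `v i`, `i ∈ s`, with sign `+` for `i ∈ t` and sign `-` otherwise. -/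
def signSum {ι E : Type*} [DecidableEq ι] [AddCommGroup E] (s t : Finset ι) (v : ι → E) : E :=
  ∑ i ∈ s, if i ∈ t then v i else -v i

section Signs

variable {ι : Type*} [DecidableEq ι]

/-- Induction step for sign averages: condition on the sign of the new vector `v j`. -/
theorem sum_powerset_signSum_insert {E : Type*} [AddCommGroup E] {s : Finset ι} {j : ι}
    (hj : j ∉ s) (v : ι → E) (F : E → ℝ) :
    ∑ t ∈ (insert j s).powerset, F (signSum (insert j s) t v) =
      ∑ t ∈ s.powerset, (F (signSum s t v - v j) + F (signSum s t v + v j)) := by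
  rw [Finset.sum_powerset_insert hj, ← Finset.sum_add_distrib]
  refine Finset.sum_congr rfl fun t ht => ?_
  have hjt : j ∉ t := fun h => hj (Finset.mem_powerset.1 ht h)
  congr 2
  · rw [signSum, Finset.sum_insert hj, if_neg hjt, signSum]
    abel
  · rw [signSum, Finset.sum_insert hj, if_pos (Finset.mem_insert_self j t), signSum, add_comm]
    congr 1
    refine Finset.sum_congr rfl fun i hi => ?_
    have hij : i ≠ j := fun h => hj (h ▸ hi)
    simp [Finset.mem_insert, hij]

variable {𝕜 : Type*} [RCLike 𝕜]

theorem sum_norm_signSum_sq (s : Finset ι) (v : ι → 𝕜) :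
    ∑ t ∈ s.powerset, ‖signSum s t v‖ ^ 2 = 2 ^ s.card * ∑ i ∈ s, ‖v i‖ ^ 2 := by
  induction s using Finset.induction_on with
  | empty => simp [signSum]
  | insert j s hj ih =>
    rw [sum_powerset_signSum_insert hj v (fun x => ‖x‖ ^ 2), Finset.card_insert_of_notMem hj,
      Finset.sum_insert hj]
    have h : ∀ t ∈ s.powerset, ‖signSum s t v - v j‖ ^ 2 + ‖signSum s t v + v j‖ ^ 2
        = 2 * ‖signSum s t v‖ ^ 2 + 2 * ‖v j‖ ^ 2 := fun t _ => by
      have := parallelogram_law_with_norm 𝕜 (signSum s t v) (v j)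
      linarith
    rw [Finset.sum_congr rfl h, Finset.sum_add_distrib, ← Finset.mul_sum, ih, Finset.sum_const,
      Finset.card_powerset, nsmul_eq_mul]
    push_cast
    ring

/-- The left side equals `2 (‖x‖² + ‖y‖²)² + 8 (re ⟨x, y⟩)²`; Cauchy–Schwarz turns `4 + 8` into the
coefficient `12`. -/
theorem norm_sub_pow_four_add_norm_add_pow_four_le (x y : 𝕜) :
    ‖x - y‖ ^ 4 + ‖x + y‖ ^ 4 ≤ 2 * ‖x‖ ^ 4 + 12 * ‖y‖ ^ 2 * ‖x‖ ^ 2 + 2 * ‖y‖ ^ 4 := by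
  have h1 := norm_add_sq (𝕜 := 𝕜) x y
  have h2 := norm_sub_sq (𝕜 := 𝕜) x y
  have h3 : RCLike.re (inner 𝕜 x y) ^ 2 ≤ (‖x‖ * ‖y‖) ^ 2 := by
    rw [sq_le_sq, abs_of_nonneg (by positivity : 0 ≤ ‖x‖ * ‖y‖)]
    exact (RCLike.abs_re_le_norm _).trans (norm_inner_le_norm x y)
  have e : ‖x - y‖ ^ 4 + ‖x + y‖ ^ 4 = (‖x - y‖ ^ 2) ^ 2 + (‖x + y‖ ^ 2) ^ 2 := by ring
  rw [e, h1, h2]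
  nlinarith

/-- With `A` the old sum of squares and `b = ‖v j‖²`, the average grows from at most `3A²` to at
most `3A² + 6Ab + b² ≤ 3(A + b)²`; the constant `3` is what absorbs the cross term. -/
theorem sum_norm_signSum_pow_four_le (s : Finset ι) (v : ι → 𝕜) :
    ∑ t ∈ s.powerset, ‖signSum s t v‖ ^ 4 ≤ 2 ^ s.card * (3 * (∑ i ∈ s, ‖v i‖ ^ 2) ^ 2) := by
  induction s using Finset.induction_on with
  | empty => simp [signSum]
  | insert j s hj ih =>
    rw [sum_powerset_signSum_insert hj v (fun x => ‖x‖ ^ 4), Finset.card_insert_of_notMem hj,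
      Finset.sum_insert hj]
    refine (Finset.sum_le_sum fun t _ =>
      norm_sub_pow_four_add_norm_add_pow_four_le (signSum s t v) (v j)).trans ?_
    rw [Finset.sum_add_distrib, Finset.sum_add_distrib, ← Finset.mul_sum, ← Finset.mul_sum,
      sum_norm_signSum_sq, Finset.sum_const, Finset.card_powerset, nsmul_eq_mul]
    push_cast
    have h2 : (0 : ℝ) ≤ 2 ^ s.card * ‖v j‖ ^ 4 := by positivity
    rw [pow_succ (2 : ℝ)]
    nlinarith

/-- A pointwise substitute for Hölder between moments. With second moment `1` and fourth moment at
most `3`, the left side averages to at least `1 - 3/4 = 1/4`, whence the `4` in `khinchine_le`. -/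
theorem sq_sub_pow_four_le_rpow {x q : ℝ} (hx : 0 ≤ x) (h1 : 1 ≤ q) (h2 : q ≤ 2) :
    x ^ 2 - x ^ 4 / 4 ≤ x ^ q := by
  rcases le_total x 1 with h | h
  · have : x ^ (2 : ℝ) ≤ x ^ q := Real.rpow_le_rpow_of_exponent_ge' hx h (by linarith) h2
    rw [Real.rpow_two] at this
    have h4 : 0 ≤ x ^ 4 := by positivity
    linarith
  · have : x ^ (1 : ℝ) ≤ x ^ q := Real.rpow_le_rpow_of_exponent_le h h1
    rw [Real.rpow_one] at this
    nlinarith [mul_nonneg hx (mul_nonneg (by linarith : (0 : ℝ) ≤ x + 2) (sq_nonneg (x - 1))),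
      mul_nonneg hx (sq_nonneg (x - 1))]

/-- Bernoulli: the tangent line of `u ^ (q/2)` at `u = 1`, with `u = x²`. It averages to `1` when
the second moment is `1`. -/
theorem one_add_sq_sub_one_le_rpow {x q : ℝ} (hx : 0 ≤ x) (h2 : 2 ≤ q) :
    1 + q / 2 * (x ^ 2 - 1) ≤ x ^ q := by
  have h := one_add_mul_self_le_rpow_one_add (s := x ^ 2 - 1) (by nlinarith [sq_nonneg x])
    (p := q / 2) (by linarith)
  rwa [add_sub_cancel, ← Real.rpow_two, ← Real.rpow_mul hx, mul_div_cancel₀ q two_ne_zero,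
    Real.rpow_two] at h

/-- Khinchine's inequality. -/
theorem khinchine_le (s : Finset ι) (v : ι → 𝕜) {q : ℝ} (hq : 1 ≤ q) :
    2 ^ s.card * (∑ i ∈ s, ‖v i‖ ^ 2) ^ (q / 2) ≤ 4 * ∑ t ∈ s.powerset, ‖signSum s t v‖ ^ q := by
  set A := ∑ i ∈ s, ‖v i‖ ^ 2 with hA
  have hA0 : 0 ≤ A := by positivity
  rcases hA0.eq_or_lt with h0 | h0
  · rw [← h0, Real.zero_rpow (by linarith), mul_zero]
    positivity
  -- Normalise to second moment `1`.
  set σ := √A with hσ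
  have hσ0 : 0 < σ := Real.sqrt_pos.2 h0
  have hσ2 : σ ^ 2 = A := Real.sq_sqrt hA0
  have hAq : A ^ (q / 2) = σ ^ q := by
    rw [← hσ2, ← Real.rpow_two, ← Real.rpow_mul hσ0.le, mul_div_cancel₀ q two_ne_zero]
  have hscale : ∀ t, ‖signSum s t v‖ ^ q = σ ^ q * (‖signSum s t v‖ / σ) ^ q := fun t => by
    rw [← Real.mul_rpow hσ0.le (by positivity), mul_div_cancel₀ _ hσ0.ne']
  have hsq : ∑ t ∈ s.powerset, (‖signSum s t v‖ / σ) ^ 2 = 2 ^ s.card := by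
    simp only [div_pow]
    rw [← Finset.sum_div, sum_norm_signSum_sq, hσ2, mul_div_cancel_right₀ _ h0.ne']
  have hfour : ∑ t ∈ s.powerset, (‖signSum s t v‖ / σ) ^ 4 ≤ 2 ^ s.card * 3 := by
    simp only [div_pow]
    rw [← Finset.sum_div, div_le_iff₀ (by positivity), show σ ^ 4 = A ^ 2 by rw [← hσ2]; ring,
      mul_assoc]
    exact sum_norm_signSum_pow_four_le s v
  rw [Finset.sum_congr rfl fun t _ => hscale t, ← Finset.mul_sum, hAq]
  suffices h : (2 : ℝ) ^ s.card ≤ 4 * ∑ t ∈ s.powerset, (‖signSum s t v‖ / σ) ^ q by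
    have := mul_le_mul_of_nonneg_left h (Real.rpow_nonneg hσ0.le q)
    linarith
  rcases le_total q 2 with h2 | h2
  · have := Finset.sum_le_sum fun t (_ : t ∈ s.powerset) => sq_sub_pow_four_le_rpow
      (div_nonneg (norm_nonneg (signSum s t v)) hσ0.le) hq h2
    rw [Finset.sum_sub_distrib, ← Finset.sum_div, hsq] at this
    linarith
  · have := Finset.sum_le_sum fun t (_ : t ∈ s.powerset) => one_add_sq_sub_one_le_rpow
      (div_nonneg (norm_nonneg (signSum s t v)) hσ0.le) h2
    rw [Finset.sum_add_distrib, ← Finset.mul_sum, Finset.sum_sub_distrib, hsq, Finset.sum_const,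
      Finset.card_powerset, nsmul_one] at this
    push_cast at this
    have h0 : (0 : ℝ) < 2 ^ s.card := by positivity
    linarith

end Signs

/-! ### Minkowski's inequality and superadditivity of powers. -/

/-- Triangle inequality in finite-dimensional `ℓ_p` for the partial sums over `n`, then a limit. -/
theorem rpow_sum_rpow_tsum_le {ι : Type*} [Fintype ι] {p : ℝ} (hp : 1 ≤ p) (f : ℕ → ι → ℝ)
    (h0 : ∀ n i, 0 ≤ f n i) (hs : ∀ i, Summable fun n => f n i)
    (hS : Summable fun n => (∑ i, f n i ^ p) ^ (1 / p)) :
    (∑ i, (∑' n, f n i) ^ p) ^ (1 / p) ≤ ∑' n, (∑ i, f n i ^ p) ^ (1 / p) := by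
  have : Fact (1 ≤ ENNReal.ofReal p) := ⟨ENNReal.one_le_ofReal.2 hp⟩
  have hp0 : 0 < p := by linarith
  have hpr : (ENNReal.ofReal p).toReal = p := ENNReal.toReal_ofReal hp0.le
  have hnorm : ∀ g : ι → ℝ, (∀ i, 0 ≤ g i) →
      ‖WithLp.toLp (ENNReal.ofReal p) g‖ = (∑ i, g i ^ p) ^ (1 / p) := fun g hg => by
    rw [PiLp.norm_eq_sum (by rw [hpr]; exact hp0), hpr]
    simp [abs_of_nonneg (hg _)]
  have hlim : Tendsto (fun K : ℕ => (∑ i, (∑ n ∈ Finset.range K, f n i) ^ p) ^ (1 / p)) atTop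
      (𝓝 ((∑ i, (∑' n, f n i) ^ p) ^ (1 / p))) :=
    (tendsto_finsetSum _ fun i _ => (hs i).hasSum.tendsto_sum_nat.rpow_const
      (Or.inr hp0.le)).rpow_const (Or.inr (by positivity))
  refine le_of_tendsto' hlim fun K => ?_
  rw [← hnorm _ fun i => Finset.sum_nonneg fun n _ => h0 n i]
  have hsum : WithLp.toLp (ENNReal.ofReal p) (fun i => ∑ n ∈ Finset.range K, f n i) =
      ∑ n ∈ Finset.range K, WithLp.toLp (ENNReal.ofReal p) (f n) := by
    rw [← WithLp.toLp_sum]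
    congr 1
    ext i
    simp
  rw [hsum]
  refine (norm_sum_le _ _).trans ?_
  rw [Finset.sum_congr rfl fun n _ => hnorm (f n) (h0 n)]
  exact hS.sum_le_tsum _ fun n _ => Real.rpow_nonneg
    (Finset.sum_nonneg fun i _ => Real.rpow_nonneg (h0 n i) _) _

theorem sum_rpow_le_rpow_sum {ι : Type*} (s : Finset ι) (f : ι → ℝ) (h0 : ∀ i, 0 ≤ f i) {p : ℝ}
    (hp : 1 ≤ p) : ∑ i ∈ s, f i ^ p ≤ (∑ i ∈ s, f i) ^ p := by
  classical
  induction s using Finset.induction_on with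
  | empty => simp [Real.zero_rpow (by linarith : p ≠ 0)]
  | insert j s hj ih =>
    rw [Finset.sum_insert hj, Finset.sum_insert hj]
    have := Real.add_rpow_le_rpow_add (h0 j) (Finset.sum_nonneg fun i _ => h0 i : 0 ≤ ∑ i ∈ s, f i)
      hp
    linarith

/-! ### The case `q ≥ 1`: cotype of `ℓ_q`. -/

namespace EllQ

variable {𝕜 : Type u} [RCLike 𝕜] {q : ℝ} [hq : Fact (0 < q)]

theorem exists_mem_dualBall (hq1 : 1 ≤ q) (y : EllQ 𝕜 q) :
    ∃ φ ∈ dualBall 𝕜 (EllQ 𝕜 q), ‖φ y‖ = ‖y‖ := by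
  have : Fact (1 ≤ ENNReal.ofReal q) := ⟨ENNReal.one_le_ofReal.2 hq1⟩
  obtain ⟨g, hg, hgy⟩ := exists_dual_vector'' 𝕜 y.toLp
  have hle : ∀ x : EllQ 𝕜 q, ‖g x.toLp‖ ≤ ‖x‖ := fun x =>
    (g.le_of_opNorm_le hg x.toLp).trans (one_mul _).le
  let f : EllQ 𝕜 q →ₗ[𝕜] 𝕜 :=
    { toFun := fun x => g x.toLp
      map_add' := fun x y => g.map_add x.toLp y.toLp
      map_smul' := fun c x => g.map_smul c x.toLp }
  refine ⟨⟨f, continuous_of_bound hasBasis_nhds_zero_norm f 1 fun x => ?_⟩, hle, ?_⟩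
  · rw [one_mul]; exact hle x
  · change ‖g y.toLp‖ = ‖y.toLp‖
    rw [hgy]
    simp

theorem coord_signSum {ι : Type*} [DecidableEq ι] (s t : Finset ι) (x : ι → EllQ 𝕜 q) (n : ℕ) :
    (signSum s t x).coord n = signSum s t fun i => (x i).coord n := by
  rw [← coordCLM_apply, signSum, map_sum, signSum]
  refine Finset.sum_congr rfl fun i _ => ?_
  split_ifs
  · rfl
  · rw [map_neg]; rfl

variable {N : ℕ} (x : Fin N → EllQ 𝕜 q)

theorem norm_signSum_le (hq1 : 1 ≤ q) (t : Finset (Fin N)) :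
    ‖signSum Finset.univ t x‖ ≤
      ⨆ φ : dualBall 𝕜 (EllQ 𝕜 q), (∑ i, ‖φ.1 (x i)‖ ^ (1 : ℝ)) ^ (1 / (1 : ℝ)) := by
  simp only [Real.rpow_one, div_one]
  obtain ⟨φ, hφ, hφx⟩ := exists_mem_dualBall hq1 (signSum Finset.univ t x)
  -- A real supremum over an unbounded family would be `0`, so boundedness is needed.
  have hbdd : BddAbove (range fun φ : dualBall 𝕜 (EllQ 𝕜 q) => ∑ i, ‖φ.1 (x i)‖) := by
    refine ⟨∑ i, ‖x i‖, ?_⟩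
    rintro _ ⟨ψ, rfl⟩
    exact Finset.sum_le_sum fun i _ => ψ.2 (x i)
  refine le_trans ?_ (le_ciSup hbdd ⟨φ, hφ⟩)
  rw [← hφx, signSum, map_sum]
  refine (norm_sum_le _ _).trans (Finset.sum_le_sum fun i _ => ?_)
  split_ifs
  · rfl
  · rw [map_neg, _root_.norm_neg]

/-- Average Khinchine over the `2 ^ N` sign choices in each coordinate and exchange the sums: each
signed sum contributes at most `M ^ q`. -/
theorem square_function_le (hq1 : 1 ≤ q) {M : ℝ} (hM : ∀ t, ‖signSum Finset.univ t x‖ ≤ M) :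
    (Summable fun n => (∑ i, ‖(x i).coord n‖ ^ 2) ^ (q / 2)) ∧
      ∑' n, (∑ i, ‖(x i).coord n‖ ^ 2) ^ (q / 2) ≤ 4 * M ^ q := by
  have hk : ∀ n, (∑ i, ‖(x i).coord n‖ ^ 2) ^ (q / 2) ≤ 4 / 2 ^ N *
      ∑ t ∈ (Finset.univ : Finset (Fin N)).powerset,
        ‖(signSum Finset.univ t x).coord n‖ ^ q := fun n => by
    have := khinchine_le Finset.univ (fun i => (x i).coord n) hq1
    rw [Finset.card_univ, Fintype.card_fin] at this
    simp only [coord_signSum]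
    rw [div_mul_eq_mul_div, le_div_iff₀ (by positivity)]
    linarith
  have hs : Summable fun n => ∑ t ∈ (Finset.univ : Finset (Fin N)).powerset,
      ‖(signSum Finset.univ t x).coord n‖ ^ q :=
    summable_sum fun t _ => summable _
  have hsum := Summable.of_nonneg_of_le (fun n => by positivity) hk (hs.mul_left _)
  refine ⟨hsum, (hsum.tsum_le_tsum hk (hs.mul_left _)).trans ?_⟩
  rw [tsum_mul_left, Summable.tsum_finsetSum fun t _ => summable _]
  have hb : ∑ t ∈ (Finset.univ : Finset (Fin N)).powerset,
      ∑' n, ‖(signSum Finset.univ t x).coord n‖ ^ q ≤ 2 ^ N * M ^ q := by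
    refine (Finset.sum_le_card_nsmul _ _ (M ^ q) fun t _ => ?_).trans (le_of_eq ?_)
    · rw [← norm_rpow]
      exact Real.rpow_le_rpow (norm_nonneg _) (hM t) hq.out.le
    · simp
  refine (mul_le_mul_of_nonneg_left hb (by positivity)).trans (le_of_eq ?_)
  field_simp

/-- For `q ≤ 2` this is Minkowski with exponent `2/q` applied to `‖(x i).coord n‖ ^ q`; for `q ≥ 2`
it is superadditivity of `u ^ (q/2)` in each coordinate. -/
theorem rpow_sum_norm_rpow_le_square_function
    (hs : Summable fun n => (∑ i, ‖(x i).coord n‖ ^ 2) ^ (q / 2)) :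
    (∑ i, ‖x i‖ ^ max 2 q) ^ (q / max 2 q) ≤ ∑' n, (∑ i, ‖(x i).coord n‖ ^ 2) ^ (q / 2) := by
  have hq0 := hq.out
  rcases le_total q 2 with h2 | h2
  · rw [max_eq_left h2]
    have hp : 1 ≤ 2 / q := by rwa [le_div_iff₀ hq0, one_mul]
    have hpow : ∀ a : ℝ, 0 ≤ a → (a ^ q) ^ (2 / q) = a ^ 2 := fun a ha => by
      rw [← Real.rpow_mul ha, mul_div_cancel₀ _ hq0.ne', Real.rpow_two]
    have hpn : ∀ i, (∑' n, ‖(x i).coord n‖ ^ q) ^ (2 / q) = ‖x i‖ ^ (2 : ℝ) := fun i => by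
      rw [← norm_rpow, hpow _ (norm_nonneg _), Real.rpow_two]
    have hpc : ∀ i n, (‖(x i).coord n‖ ^ q) ^ (2 / q) = ‖(x i).coord n‖ ^ 2 := fun i n =>
      hpow _ (_root_.norm_nonneg _)
    have h := rpow_sum_rpow_tsum_le hp (fun n i => ‖(x i).coord n‖ ^ q)
      (fun n i => by positivity) (fun i => summable (x i))
    simp only [hpn, hpc, one_div_div] at h
    exact h hs
  · rw [max_eq_right h2, div_self hq0.ne', Real.rpow_one]
    simp only [norm_rpow]
    rw [← Summable.tsum_finsetSum fun i _ => summable _]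
    refine (summable_sum fun i _ => summable _).tsum_le_tsum (fun n => ?_) hs
    refine le_trans (Finset.sum_le_sum fun i _ => le_of_eq ?_) (sum_rpow_le_rpow_sum Finset.univ
      (fun i => ‖(x i).coord n‖ ^ 2) (fun i => by positivity) (by linarith : 1 ≤ q / 2))
    rw [← Real.rpow_two, ← Real.rpow_mul (_root_.norm_nonneg _), mul_div_cancel₀ q two_ne_zero]

/-- For `q ≥ 1`, every bounded operator on `ℓ_q` is absolutely `(max 2 q, 1)`-summing. -/
theorem isAbsSumming_of_one_le (hq1 : 1 ≤ q) (T : EllQ 𝕜 q →L[𝕜] EllQ 𝕜 q) :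
    IsAbsSumming (max 2 q) 1 T := by
  obtain ⟨B, hB, hT⟩ := exists_bound T
  have hq0 := hq.out
  have hr : 0 < max 2 q := by positivity
  refine ⟨B * 4, by positivity, fun N x => ?_⟩
  set M := ⨆ φ : dualBall 𝕜 (EllQ 𝕜 q), (∑ i, ‖φ.1 (x i)‖ ^ (1 : ℝ)) ^ (1 / (1 : ℝ)) with hMdef
  have hM : ∀ t, ‖signSum Finset.univ t x‖ ≤ M := norm_signSum_le x hq1
  have hM0 : 0 ≤ M := (norm_nonneg _).trans (hM ∅)
  obtain ⟨hs, hle⟩ := square_function_le x hq1 hM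
  have h1 := (rpow_sum_norm_rpow_le_square_function x hs).trans hle
  have hS0 : 0 ≤ ∑ i, ‖x i‖ ^ max 2 q :=
    Finset.sum_nonneg fun i _ => Real.rpow_nonneg (norm_nonneg _) _
  have h2 : (∑ i, ‖x i‖ ^ max 2 q) ^ (1 / max 2 q) ≤ 4 * M := by
    refine (Real.rpow_le_rpow_iff (Real.rpow_nonneg hS0 _) (by positivity) hq0).1 ?_
    rw [← Real.rpow_mul hS0, one_div_mul_eq_div, Real.mul_rpow (by norm_num) hM0]
    refine h1.trans (mul_le_mul_of_nonneg_right ?_ (Real.rpow_nonneg hM0 _))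
    -- Since `q ≥ 1`, the constant `4` may be replaced by `4 ^ q`, so that `q`-th roots leave `4 *
    -- M`.
    simpa using Real.rpow_le_rpow_of_exponent_le (by norm_num : (1 : ℝ) ≤ 4) hq1
  have h3 : (∑ i, ‖T (x i)‖ ^ max 2 q) ^ (1 / max 2 q) ≤
      B * (∑ i, ‖x i‖ ^ max 2 q) ^ (1 / max 2 q) := by
    have hBr : B = (B ^ max 2 q) ^ (1 / max 2 q) := by
      rw [← Real.rpow_mul hB.le, mul_one_div_cancel hr.ne', Real.rpow_one]
    rw [hBr, ← Real.mul_rpow (by positivity) hS0, Finset.mul_sum]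
    refine Real.rpow_le_rpow (Finset.sum_nonneg fun i _ => Real.rpow_nonneg (norm_nonneg _) _)
      (Finset.sum_le_sum fun i _ => ?_) (by positivity)
    rw [← Real.mul_rpow hB.le (norm_nonneg _)]
    exact Real.rpow_le_rpow (norm_nonneg _) (hT _) hr.le
  refine h3.trans ?_
  rw [mul_assoc]
  exact mul_le_mul_of_nonneg_left h2 hB.le

theorem nonSummingOps_eq_empty (hq1 : 1 ≤ q) : nonSummingOps 𝕜 q = ∅ := by
  refine eq_empty_of_forall_notMem fun T hT => hT.2 ?_
  simp only [mem_iUnion]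
  exact ⟨max 2 q, 1, ⟨le_rfl, le_max_of_le_left one_le_two⟩, isAbsSumming_of_one_le hq1 T⟩

theorem not_isSpaceable_nonSummingOps (hq1 : 1 ≤ q) :
    ¬ IsSpaceable 𝕜 Cardinal.continuum (nonSummingOps 𝕜 q) := by
  rintro ⟨W, -, hrank, hW⟩
  rw [nonSummingOps_eq_empty hq1, empty_union] at hW
  have hbot : W = ⊥ := (Submodule.eq_bot_iff W).2 fun T hT => hW hT
  rw [hbot, rank_bot] at hrank
  exact Cardinal.continuum_ne_zero hrank.symm

end EllQ

end

theorem theorem3p4 (𝕜 : Type u) [RCLike 𝕜] (q : ℝ) [Fact (0 < q)] :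
    (q < 1 → IsSpaceable 𝕜 Cardinal.continuum (nonSummingOps 𝕜 q)) ∧
    (1 ≤ q →
      (∀ T : EllQ 𝕜 q →L[𝕜] EllQ 𝕜 q, IsAbsSumming (max 2 q) 1 T) ∧
      ¬ IsSpaceable 𝕜 Cardinal.continuum (nonSummingOps 𝕜 q)) :=
  ⟨EllQ.isSpaceable_nonSummingOps, fun h =>
    ⟨EllQ.isAbsSumming_of_one_le h, EllQ.not_isSpaceable_nonSummingOps h⟩⟩
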